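/- There are absolute constants $0<c_1\le c_2$, $c>0$ and $k\in\mathbb N$ such that the following holds for all $m,n,t\in\mathbb N$ with $1\le t\le m^{3/2}/2$ and $n\ge 4\sqrt m$. Let $V$ be a set of $n$ vertices. An Edge Emptiness (EE) query to a simple undirected graph $G=(V,E)$ specifies a set $P\subseteq\binom V2$ and is answered by whether $P\cap E\neq\emptyset$. Let $\mathcal A$ be a randomized adaptive algorithm that knows $V,m,t$ and accesses the unknown graph $G$ only through EE queries, such that for every graph $G$ on $V$ with $c_1m\le |E|\le c_2m$: if $G$ has at most $t$ triangles, then $\mathcal A$ outputs "at most $t$" with probability at least $2/3$, and if $G$ has at least $2t$ triangles, then $\mathcal A$ outputs "at least $2t$" with probability at least $2/3$. If, on every such graph with at most $t$ or at least $2t$ triangles and for every outcome of its random choices, $\mathcal A$ makes at most $q$ queries, then $$q\;\ge\;\frac{c}{(\log n)^k}\,\min\left\{\frac{m}{\sqrt t},\ \frac{m^{3/2}}{t}\right\}.$$ The same holds, with the same constants, if EE queries are replaced by Bipartite Independent Set (BIS) queries (given disjoint $U,U'\subseteq V$, is there an edge between $U$ and $U'$?), and if they are replaced by Independent Set (IS)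 queries (given $U\subseteq V$, is there an edge with both endpoints in $U$?). -/

import Mathlib

/-- A Boolean query oracle for graphs on the vertex set `Fin n`: the admissible queries, and the
answer to each of them on each graph. -/
structure GraphOracle (n : ℕ) where
  Query : Type
  answer : SimpleGraph (Fin n) → Query → Bool

open Classical in
/-- Edge Emptiness: given a set `P` of pairs of distinct vertices, does `P` contain an edge? -/
noncomputable def eeOracle (n : ℕ) : GraphOracle n where
  Query := {P : Finset (Sym2 (Fin n)) // ∀ e ∈ P, ¬ e.IsDiag}
  answer G P := decide (∃ e ∈ P.1, e ∈ G.edgeSet)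

open Classical in
/-- Bipartite Independent Set: given disjoint `U, U'`, is there an edge between them? -/
noncomputable def bisOracle (n : ℕ) : GraphOracle n where
  Query := {U : Finset (Fin n) × Finset (Fin n) // Disjoint U.1 U.2}
  answer G U := decide (∃ u ∈ U.1.1, ∃ v ∈ U.1.2, G.Adj u v)

open Classical in
/-- Independent Set: given `U`, is there an edge between vertices of `U`? -/
noncomputable def isOracle (n : ℕ) : GraphOracle n where
  Query := Finset (Fin n)
  answer G U := decide (∃ u ∈ U, ∃ v ∈ U, G.Adj u v)

/-- A deterministic adaptive query algorithm with Boolean output, as a decision tree. -/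
inductive DecisionTree (Q : Type) : Type
  | output (b : Bool) : DecisionTree Q
  | query (x : Q) (next : Bool → DecisionTree Q) : DecisionTree Q

namespace DecisionTree

/-- The output of the algorithm when query `x` is answered by `ans x`. -/
def run {Q : Type} (ans : Q → Bool) : DecisionTree Q → Bool
  | output b => b
  | query x next => run ans (next (ans x))

/-- The number of queries made when query `x` is answered by `ans x`. -/
def numQueries {Q : Type} (ans : Q → Bool) : DecisionTree Q → ℕ
  | output _ => 0
  | query x next => numQueries ans (next (ans x)) + 1

end DecisionTree

/-- A randomized query algorithm: a random deterministic one. -/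
abbrev RandomizedAlgorithm {n : ℕ} (O : GraphOracle n) : Type := PMF (DecisionTree O.Query)

/-- The probability that the algorithm `A` outputs `b` on the graph `G`. -/
noncomputable def RandomizedAlgorithm.probOutput {n : ℕ} {O : GraphOracle n}
    (A : RandomizedAlgorithm O) (G : SimpleGraph (Fin n)) (b : Bool) : ENNReal :=
  PMF.map (fun T => T.run (O.answer G)) A b

/-- The number of triangles of a graph. -/
noncomputable def numTriangles {n : ℕ} (G : SimpleGraph (Fin n)) : ℕ := (G.cliqueSet 3).ncard

/-- The number of edges of `G` lies between `c₁ m` and `c₂ m`. -/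
def EdgesBetween {n : ℕ} (c₁ c₂ : ℝ) (m : ℕ) (G : SimpleGraph (Fin n)) : Prop :=
  c₁ * m ≤ (G.edgeSet.ncard : ℝ) ∧ (G.edgeSet.ncard : ℝ) ≤ c₂ * m

/-- The promise: `G` has between `c₁ m` and `c₂ m` edges, and at most `t` or at least `2t`
triangles. -/
def TrianglePromise {n : ℕ} (c₁ c₂ : ℝ) (m t : ℕ) (G : SimpleGraph (Fin n)) : Prop :=
  EdgesBetween c₁ c₂ m G ∧ (numTriangles G ≤ t ∨ 2 * t ≤ numTriangles G)

/-- On each graph with between `c₁ m` and `c₂ m` edges, `A` gives, with probability at least `2/3`,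
the answer `false` if there are at most `t` triangles and the answer `true` if there are at
least `2t`. -/
def DecidesTriangles {n : ℕ} {O : GraphOracle n} (c₁ c₂ : ℝ) (m t : ℕ)
    (A : RandomizedAlgorithm O) : Prop :=
  ∀ G : SimpleGraph (Fin n), EdgesBetween c₁ c₂ m G →
    (numTriangles G ≤ t → 2 / 3 ≤ A.probOutput G false) ∧
    (2 * t ≤ numTriangles G → 2 / 3 ≤ A.probOutput G true)

/-- Whatever its random choices, `A` makes at most `q` queries on each graph that satisfies the
promise. -/
def MakesAtMost {n : ℕ} {O : GraphOracle n} (c₁ c₂ : ℝ) (m t : ℕ)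
    (A : RandomizedAlgorithm O) (q : ℕ) : Prop :=
  ∀ G : SimpleGraph (Fin n), TrianglePromise c₁ c₂ m t G →
    ∀ T ∈ PMF.support A, T.numQueries (O.answer G) ≤ q

/-! Put `s ≈ √m` vertices next to `l` pairs of blocks of size `b`, with `l * b ≈ s`. A bit `y (x,
j)` selects the one block of pair `j` that `x` is joined to, so the graph is triangle-free. Planting
a set of `r` variables joins each of those `x` to both blocks, creating `b ^ 2` triangles per
variable. Every query is a clause in the literals.

Scan a clause until a true literal stops the scan. A query stops at most one scan, and for uniform
`y` a freshly probed variable satisfies its clause with probability at least `1 / 2`, so `q` queries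
probe at most `2 * q` variables on average (`sum_card_probed_le`, `card_hits_le`). Planting goes
unnoticed unless a planted variable is probed (`run_planted_eq`). A random translate of an `r`-set
contains a given variable with probability `r / (s * l)`, hence is noticed with probability at most
`2 * q * r / (s * l)`. Correctness requires `1 / 3`, so `s * l ≤ 6 * q * r`. The two terms of the
minimum come from `r = 1` and from `l = 1`. -/

/-! ### Clauses and the probing of variables -/

/-- The answer of a query that is a clause in the literals `(v, c)`, in a state `σ` that says which
literals hold; `fix x` means that the clause `x` holds in every state. -/
noncomputable def clauseAnswer {Q V : Type} (fix : Q → Prop) (lit : Q → V → Bool → Prop)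
    (σ : V → Bool → Prop) (x : Q) : Bool :=
  open Classical in decide (fix x ∨ ∃ v c, lit x v c ∧ σ v c)

theorem clauseAnswer_eq_true_iff {Q V : Type} (fix : Q → Prop) (lit : Q → V → Bool → Prop)
    (σ : V → Bool → Prop) (x : Q) :
    clauseAnswer fix lit σ x = true ↔ fix x ∨ ∃ v c, lit x v c ∧ σ v c := by
  simp [clauseAnswer]

/-- The state in which exactly the literals `(v, y v)` hold. -/
def plainState {V : Type} (y : V → Bool) : V → Bool → Prop := fun v c => y v = c

/-- The state in which, moreover, both literals of each variable in `S` hold. -/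
def plantedState {V : Type} (y : V → Bool) (S : Finset V) : V → Bool → Prop :=
  fun v c => y v = c ∨ v ∈ S

/-- When the variables of the clause `x` are probed in the order of `rk` until a literal of `x` is
found to hold, the variable `v` is probed. -/
def Probes {Q V : Type} (fix : Q → Prop) (lit : Q → V → Bool → Prop) (rk : V → ℕ)
    (y : V → Bool) (x : Q) (v : V) : Prop :=
  ¬ fix x ∧ (∃ c, lit x v c) ∧ ∀ w, rk w < rk v → ¬ lit x w (y w)

open Classical in
/-- The first query of the algorithm that probes the variable `v`. -/
noncomputable def firstProbe {Q V : Type} (fix : Q → Prop) (lit : Q → V → Bool → Prop) (rk : V → ℕ)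
    (y : V → Bool) (v : V) : DecisionTree Q → Option Q
  | .output _ => none
  | .query x next =>
      if Probes fix lit rk y x v then some x
      else firstProbe fix lit rk y v (next (clauseAnswer fix lit (plainState y) x))

section Probing

variable {Q V : Type} (fix : Q → Prop) (lit : Q → V → Bool → Prop) (rk : V → ℕ)

/-- Planting only adds true literals, so an answer can only change from false to true. A clause that
is false in the plain state is scanned to the end, so all its variables are probed. -/
theorem clauseAnswer_planted_eq (y : V → Bool) (S : Finset V) (x : Q)
    (h : ∀ v ∈ S, ¬ Probes fix lit rk y x v) :
    clauseAnswer fix lit (plantedState y S) x = clauseAnswer fix lit (plainState y) x := by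
  unfold clauseAnswer
  rw [decide_eq_decide]
  constructor
  · rintro (hf | ⟨v, c, hl, hv | hv⟩)
    · exact Or.inl hf
    · exact Or.inr ⟨v, c, hl, hv⟩
    · by_contra hn
      rw [not_or] at hn
      exact h v hv ⟨hn.1, ⟨c, hl⟩, fun w _ hw => hn.2 ⟨w, y w, hw, rfl⟩⟩
  · rintro (hf | ⟨v, c, hl, hv⟩)
    · exact Or.inl hf
    · exact Or.inr ⟨v, c, hl, Or.inl hv⟩

/-- An algorithm that probes no variable of `S` does not notice that `S` is planted. -/
theorem run_planted_eq (y : V → Bool) (S : Finset V) (T : DecisionTree Q)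
    (h : ∀ v ∈ S, firstProbe fix lit rk y v T = none) :
    T.run (clauseAnswer fix lit (plantedState y S)) =
      T.run (clauseAnswer fix lit (plainState y)) := by
  induction T with
  | output b => rfl
  | query x next ih =>
    have hx : ∀ v ∈ S, ¬ Probes fix lit rk y x v := fun v hv hp => by
      have := h v hv
      simp [firstProbe, hp] at this
    simp only [DecisionTree.run]
    rw [clauseAnswer_planted_eq fix lit rk y S x hx]
    refine ih _ fun v hv => ?_
    simpa [firstProbe, hx v hv] using h v hv

theorem exists_lit_of_firstProbe {y : V → Bool} {v : V} {x : Q} {T : DecisionTree Q}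
    (h : firstProbe fix lit rk y v T = some x) : ∃ c, lit x v c := by
  induction T with
  | output b => simp [firstProbe] at h
  | query z next ih =>
    by_cases hp : Probes fix lit rk y z v
    · simp only [firstProbe, hp, if_true, Option.some.injEq] at h
      exact h ▸ hp.2.1
    · simp only [firstProbe, hp, if_false] at h
      exact ih _ h

variable [DecidableEq V]

theorem probes_flip_iff (y : V → Bool) (v : V) (b : Bool) (x : Q) :
    Probes fix lit rk (Function.update y v b) x v ↔ Probes fix lit rk y x v := by
  have : ∀ w, rk w < rk v → Function.update y v b w = y w := fun w hw =>
    Function.update_of_ne (by rintro rfl; exact lt_irrefl _ hw) _ _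
  unfold Probes
  refine and_congr_right fun _ => and_congr_right fun _ => forall_congr' fun w =>
    forall_congr' fun hw => ?_
  rw [this w hw]

/-- A clause that does not probe `v` is fixed, does not contain `v`, or is already satisfied by a
variable of lower rank. -/
theorem clauseAnswer_flip_eq (y : V → Bool) (v : V) (b : Bool) (x : Q)
    (h : ¬ Probes fix lit rk y x v) :
    clauseAnswer fix lit (plainState (Function.update y v b)) x =
      clauseAnswer fix lit (plainState y) x := by
  unfold clauseAnswer plainState
  rw [decide_eq_decide]
  by_cases hf : fix x
  · simp [hf]
  by_cases hl : ∃ c, lit x v c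
  · have : ∃ w, rk w < rk v ∧ lit x w (y w) := by
      by_contra hn
      push Not at hn
      exact h ⟨hf, hl, hn⟩
    obtain ⟨w, hw, hlw⟩ := this
    have hne : w ≠ v := by rintro rfl; exact lt_irrefl _ hw
    exact iff_of_true (Or.inr ⟨w, y w, hlw, Function.update_of_ne hne _ _⟩)
      (Or.inr ⟨w, y w, hlw, rfl⟩)
  · push Not at hl
    refine or_congr_right (exists_congr fun w => exists_congr fun c =>
      and_congr_right fun hwc => ?_)
    have hne : w ≠ v := by rintro rfl; exact hl _ hwc
    rw [Function.update_of_ne hne]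

/-- The first query that probes `v` does not depend on the value of `v`. -/
theorem firstProbe_flip (y : V → Bool) (v : V) (b : Bool) (T : DecisionTree Q) :
    firstProbe fix lit rk (Function.update y v b) v T = firstProbe fix lit rk y v T := by
  induction T with
  | output b => rfl
  | query x next ih =>
    by_cases hp : Probes fix lit rk y x v
    · simp [firstProbe, hp, probes_flip_iff]
    · simp only [firstProbe, hp, probes_flip_iff, if_false]
      rw [clauseAnswer_flip_eq fix lit rk y v b x hp, ih]

end Probing

/-! ### Counting probed variables and noticed plantings -/

section Counting

variable {Q V : Type} [Fintype V] [DecidableEq V] (fix : Q → Prop) (lit : Q → V → Bool → Prop)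
  (rk : V → ℕ)

open Classical in
/-- The variables probed by the algorithm. -/
noncomputable def probed (y : V → Bool) (T : DecisionTree Q) : Finset V :=
  Finset.univ.filter fun v => (firstProbe fix lit rk y v T).isSome

open Classical in
/-- The variables whose first probe satisfies the query. -/
noncomputable def hits (y : V → Bool) (T : DecisionTree Q) : Finset V :=
  Finset.univ.filter fun v => ∃ x, firstProbe fix lit rk y v T = some x ∧ lit x v (y v)

/-- A scan stops at its first true literal, so each query on the path contributes at most one hit.
-/
theorem card_hits_le (hrk : Function.Injective rk) (y : V → Bool) (T : DecisionTree Q) :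
    (hits fix lit rk y T).card ≤ T.numQueries (clauseAnswer fix lit (plainState y)) := by
  classical
  induction T with
  | output b => simp [hits, firstProbe]
  | query x next ih =>
    set ans := clauseAnswer fix lit (plainState y) x with hans
    let D : Finset V := Finset.univ.filter fun v => Probes fix lit rk y x v ∧ lit x v (y v)
    have hD : D.card ≤ 1 := by
      refine Finset.card_le_one.2 fun v hv w hw => ?_
      simp only [D, Finset.mem_filter, Finset.mem_univ, true_and] at hv hw
      refine hrk (le_antisymm (not_lt.1 fun hlt => ?_) (not_lt.1 fun hlt => ?_))
      · exact hv.1.2.2 w hlt hw.2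
      · exact hw.1.2.2 v hlt hv.2
    have hsub : hits fix lit rk y (.query x next) ⊆ D ∪ hits fix lit rk y (next ans) := by
      intro v hv
      simp only [hits, D, Finset.mem_union, Finset.mem_filter, Finset.mem_univ, true_and] at hv ⊢
      obtain ⟨z, hz, hl⟩ := hv
      by_cases hp : Probes fix lit rk y x v
      · simp only [firstProbe, hp, if_true, Option.some.injEq] at hz
        exact Or.inl ⟨hp, hz ▸ hl⟩
      · simp only [firstProbe, hp, if_false] at hz
        exact Or.inr ⟨z, hz, hl⟩
    have h1 := (Finset.card_le_card hsub).trans (Finset.card_union_le _ _)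
    have h2 := ih ans
    simp only [DecisionTree.numQueries]
    rw [← hans]
    omega

/-- On average over the assignments, at least half of the probed variables are hits. -/
theorem sum_card_probed_le (T : DecisionTree Q) :
    ∑ y : V → Bool, (probed fix lit rk y T).card ≤
      2 * ∑ y : V → Bool, (hits fix lit rk y T).card := by
  classical
  have hswap : ∀ F : (V → Bool) → Finset V, ∑ y, (F y).card =
      ∑ v, (Finset.univ.filter fun y => v ∈ F y).card := fun F => by
    simp only [Finset.card_eq_sum_ones, Finset.sum_filter]
    rw [Finset.sum_comm]
    simp
  rw [hswap, hswap, Finset.mul_sum]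
  refine Finset.sum_le_sum fun v _ => ?_
  let flip : (V → Bool) → (V → Bool) := fun y => Function.update y v (!y v)
  have hflip : Function.Injective flip := by
    have : Function.Involutive flip := fun y => by simp [flip]
    exact this.injective
  set H := Finset.univ.filter fun y => v ∈ hits fix lit rk y T
  -- The first probe of `v` is the same query for `y` and `flip y`, and it contains a literal of
  -- `v`; one of the two assignments makes that literal true.
  have hsub : (Finset.univ.filter fun y => v ∈ probed fix lit rk y T) ⊆
      H ∪ Finset.univ.filter fun y => flip y ∈ H := by
    intro y hy
    simp only [H, hits, probed, Finset.mem_union, Finset.mem_filter, Finset.mem_univ,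
      true_and] at hy ⊢
    obtain ⟨x, hx⟩ := Option.isSome_iff_exists.1 hy
    obtain ⟨c, hc⟩ := exists_lit_of_firstProbe fix lit rk hx
    by_cases hyc : y v = c
    · exact Or.inl ⟨x, hx, hyc ▸ hc⟩
    · refine Or.inr ⟨x, ?_, ?_⟩
      · simp only [flip]
        rw [firstProbe_flip, hx]
      · have : flip y v = c := by
          simp only [flip, Function.update_self]
          cases h : y v <;> cases c <;> simp_all
        rwa [this]
  have hle : (Finset.univ.filter fun y => flip y ∈ H).card ≤ H.card :=
    Finset.card_le_card_of_injOn flip (fun y hy => by simpa using hy) hflip.injOn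
  calc _ ≤ _ := Finset.card_le_card hsub
    _ ≤ _ := Finset.card_union_le _ _
    _ ≤ 2 * H.card := by omega

/-- A shallow algorithm notices few of the planted sets `S i`, if no variable lies in many of
them. -/
theorem card_run_ne_le {ι : Type} [Fintype ι] (S : ι → Finset V) {d q : ℕ}
    (hS : ∀ v, (Finset.univ.filter fun i => v ∈ S i).card ≤ d) (T : DecisionTree Q)
    (hT : ∀ y, T.numQueries (clauseAnswer fix lit (plainState y)) ≤ q) :
    (Finset.univ.filter fun p : (V → Bool) × ι =>
      T.run (clauseAnswer fix lit (plantedState p.1 (S p.2))) ≠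
        T.run (clauseAnswer fix lit (plainState p.1))).card ≤
      2 * q * d * Fintype.card (V → Bool) := by
  classical
  let rk : V → ℕ := fun v => Fintype.equivFin V v
  have hrk : Function.Injective rk := Fin.val_injective.comp (Fintype.equivFin V).injective
  have hprobed : ∑ y : V → Bool, (probed fix lit rk y T).card ≤
      2 * (Fintype.card (V → Bool) * q) := by
    refine (sum_card_probed_le fix lit rk T).trans (Nat.mul_le_mul_left _ ?_)
    refine (Finset.sum_le_card_nsmul _ _ q fun y _ =>
      (card_hits_le fix lit rk hrk y T).trans (hT y)).trans ?_
    simp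
  -- Union bound: a noticed set contains a probed variable, and each variable lies in at most `d`
  -- sets.
  have hrow : ∀ y : V → Bool, (Finset.univ.filter fun i =>
      T.run (clauseAnswer fix lit (plantedState y (S i))) ≠
        T.run (clauseAnswer fix lit (plainState y))).card ≤
      (probed fix lit rk y T).card * d := fun y => by
    refine (Finset.card_le_card (t := (probed fix lit rk y T).biUnion fun v =>
      Finset.univ.filter fun i => v ∈ S i) fun i hi => ?_).trans
        (Finset.card_biUnion_le_card_mul _ _ _ fun v _ => hS v)
    simp only [Finset.mem_filter, Finset.mem_univ, true_and, Finset.mem_biUnion, probed] at hi ⊢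
    by_contra hn
    push Not at hn
    refine hi (run_planted_eq fix lit rk y (S i) T fun v hv => ?_)
    by_contra hne
    exact hn v (Option.isSome_iff_ne_none.2 hne) hv
  calc _ = ∑ y : V → Bool, (Finset.univ.filter fun i =>
      T.run (clauseAnswer fix lit (plantedState y (S i))) ≠
        T.run (clauseAnswer fix lit (plainState y))).card := by
        simp only [Finset.card_filter]
        rw [Fintype.sum_prod_type]
    _ ≤ ∑ y : V → Bool, (probed fix lit rk y T).card * d := Finset.sum_le_sum fun y _ => hrow y
    _ ≤ 2 * (Fintype.card (V → Bool) * q) * d := by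
        rw [← Finset.sum_mul]
        exact Nat.mul_le_mul_right _ hprobed
    _ = _ := by ring

end Counting

/-! ### Block graphs: queries, edges and triangles -/

/-- The vertices `Fin s`, and pairs of blocks of `b` vertices each, indexed by `Fin l`. -/
abbrev BlockVertex (s l b : ℕ) : Type := Fin s ⊕ (Fin l × Bool × Fin b)

/-- The two blocks of each pair are completely joined, and the vertex `x` is completely joined to
the block `(j, c)` if `σ (x, j) c`. -/
def blockGraph {s l : ℕ} (b : ℕ) (σ : Fin s × Fin l → Bool → Prop) :
    SimpleGraph (BlockVertex s l b) where
  Adj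
    | .inl _, .inl _ => False
    | .inl x, .inr (j, c, _) => σ (x, j) c
    | .inr (j, c, _), .inl x => σ (x, j) c
    | .inr (j, c, _), .inr (j', c', _) => j = j' ∧ c ≠ c'
  symm := ⟨by
    rintro (x | ⟨j, c, k⟩) (x' | ⟨j', c', k'⟩) h
    · exact h
    · exact h
    · exact h
    · exact ⟨h.1.symm, h.2.symm⟩⟩
  loopless := ⟨by
    rintro (x | ⟨j, c, k⟩) h
    · exact h
    · exact h.2 rfl⟩

section BlockGraph

variable {s l b n : ℕ}

/-- On block graphs, an edge emptiness query is a clause. -/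
theorem exists_mem_edgeSet_map_blockGraph_iff (σ : Fin s × Fin l → Bool → Prop)
    (f : BlockVertex s l b ↪ Fin n) (P : Set (Sym2 (Fin n))) :
    (∃ e ∈ P, e ∈ ((blockGraph b σ).map f).edgeSet) ↔
      (∃ j k k', s(f (.inr (j, false, k)), f (.inr (j, true, k'))) ∈ P) ∨
        ∃ v c, (∃ k, s(f (.inl v.1), f (.inr (v.2, c, k))) ∈ P) ∧ σ v c := by
  rw [SimpleGraph.edgeSet_map]
  constructor
  · rintro ⟨_, hP, e, he, rfl⟩
    induction e with
    | _ u w =>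
    rw [SimpleGraph.mem_edgeSet] at he
    simp only [Function.Embedding.sym2Map_apply, Sym2.map_mk] at hP
    rcases u with x | ⟨j, c, k⟩ <;> rcases w with x' | ⟨j', c', k'⟩
    · exact he.elim
    · exact Or.inr ⟨(x, j'), c', ⟨k', hP⟩, he⟩
    · exact Or.inr ⟨(x', j), c, ⟨k, Sym2.eq_swap ▸ hP⟩, he⟩
    · obtain ⟨rfl, hc⟩ := he
      cases c <;> cases c'
      · exact (hc rfl).elim
      · exact Or.inl ⟨j, k, k', hP⟩
      · exact Or.inl ⟨j, k', k, Sym2.eq_swap ▸ hP⟩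
      · exact (hc rfl).elim
  · rintro (⟨j, k, k', hP⟩ | ⟨⟨x, j⟩, c, ⟨k, hP⟩, hσ⟩)
    · exact ⟨_, hP, s(.inr (j, false, k), .inr (j, true, k')),
        ⟨rfl, Bool.false_ne_true⟩, rfl⟩
    · exact ⟨_, hP, s(.inl x, .inr (j, c, k)), hσ, rfl⟩

theorem ncard_edgeSet_map_blockGraph (σ : Fin s × Fin l → Bool → Prop)
    (f : BlockVertex s l b ↪ Fin n) :
    ((blockGraph b σ).map f).edgeSet.ncard = (blockGraph b σ).edgeSet.ncard := by
  rw [SimpleGraph.edgeSet_map]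
  exact Set.ncard_image_of_injective _ f.sym2Map.injective

theorem mul_le_ncard_edgeSet_blockGraph (σ : Fin s × Fin l → Bool → Prop)
    (hσ : ∀ v, ∃ c, σ v c) : s * l * b ≤ (blockGraph b σ).edgeSet.ncard := by
  choose y hy using hσ
  let g : (Fin s × Fin l) × Fin b → Sym2 (BlockVertex s l b) :=
    fun p => s(.inl p.1.1, .inr (p.1.2, y p.1, p.2))
  have hg : Function.Injective g := by
    rintro ⟨⟨x, j⟩, k⟩ ⟨⟨x', j'⟩, k'⟩ h
    simp only [g, Sym2.eq_iff, Sum.inl.injEq, Sum.inr.injEq, Prod.mk.injEq, reduceCtorEq,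
      false_and, or_false] at h
    obtain ⟨rfl, rfl, -, rfl⟩ := h
    rfl
  have := Set.ncard_le_ncard (s := Set.range g) (t := (blockGraph b σ).edgeSet)
    (by rintro _ ⟨p, rfl⟩; exact hy p.1) (Set.toFinite _)
  rwa [← Set.image_univ, Set.ncard_image_of_injective _ hg, Set.ncard_univ, Nat.card_eq_fintype_card,
    Fintype.card_prod, Fintype.card_prod, Fintype.card_fin, Fintype.card_fin,
    Fintype.card_fin] at this

theorem ncard_edgeSet_le_card_sq {α : Type} [Fintype α] (G : SimpleGraph α) :
    G.edgeSet.ncard ≤ Fintype.card α ^ 2 := by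
  classical
  rw [← SimpleGraph.coe_edgeFinset, Set.ncard_coe_finset]
  exact G.card_edgeFinset_le_card_choose_two.trans (Nat.choose_le_pow _ _)

theorem numTriangles_map_blockGraph (σ : Fin s × Fin l → Bool → Prop)
    (f : BlockVertex s l b ↪ Fin n) :
    numTriangles ((blockGraph b σ).map f) = ((blockGraph b σ).cliqueSet 3).ncard := by
  rw [numTriangles, SimpleGraph.cliqueSet_map (by norm_num)]
  exact Set.ncard_image_of_injective _ (Finset.map_injective f)

/-- A triangle with a vertex `x` in `Fin s` would join `x` to both blocks of one pair, and the
blocks alone span a bipartite graph. -/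
theorem cliqueSet_blockGraph_plainState (y : Fin s × Fin l → Bool) :
    (blockGraph b (plainState y)).cliqueSet 3 = ∅ := by
  classical
  rw [Set.eq_empty_iff_forall_notMem]
  intro t ht
  rw [SimpleGraph.mem_cliqueSet_iff, SimpleGraph.is3Clique_iff] at ht
  obtain ⟨u, v, w, huv, huw, hvw, -⟩ := ht
  rcases u with x | ⟨j, c, k⟩ <;> rcases v with x' | ⟨j', c', k'⟩ <;>
    rcases w with x'' | ⟨j'', c'', k''⟩ <;>
    simp only [blockGraph, plainState] at huv huw hvw
  · exact hvw.2 (by rw [← huv, ← huw, hvw.1])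
  · exact huw.2 (by rw [← huv, ← hvw, huw.1])
  · exact huv.2 (by rw [← huw, ← hvw, huv.1])
  · obtain ⟨-, h₁⟩ := huv
    obtain ⟨-, h₂⟩ := huw
    obtain ⟨-, h₃⟩ := hvw
    cases c <;> cases c' <;> cases c'' <;> simp_all

theorem mul_le_ncard_cliqueSet_blockGraph_plantedState (y : Fin s × Fin l → Bool)
    (S : Finset (Fin s × Fin l)) :
    S.card * b ^ 2 ≤ ((blockGraph b (plantedState y S)).cliqueSet 3).ncard := by
  classical
  let g : S × Fin b × Fin b → Finset (BlockVertex s l b) :=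
    fun p => {.inl p.1.1.1, .inr (p.1.1.2, false, p.2.1), .inr (p.1.1.2, true, p.2.2)}
  have hg : Function.Injective g := by
    rintro ⟨⟨⟨x, j⟩, h⟩, k, k'⟩ ⟨⟨⟨x', j'⟩, h'⟩, i, i'⟩ he
    have h₁ : (.inl x : BlockVertex s l b) ∈ g ⟨⟨(x', j'), h'⟩, i, i'⟩ := by
      rw [← he]; simp [g]
    have h₂ : (.inr (j, false, k) : BlockVertex s l b) ∈ g ⟨⟨(x', j'), h'⟩, i, i'⟩ := by
      rw [← he]; simp [g]
    have h₃ : (.inr (j, true, k') : BlockVertex s l b) ∈ g ⟨⟨(x', j'), h'⟩, i, i'⟩ := by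
      rw [← he]; simp [g]
    simp only [g, Finset.mem_insert, Finset.mem_singleton, Sum.inl.injEq, Sum.inr.injEq,
      Prod.mk.injEq, reduceCtorEq, or_false, false_or, true_and, false_and,
      and_false] at h₁ h₂ h₃
    obtain ⟨rfl, rfl⟩ := h₂
    obtain ⟨-, rfl⟩ := h₃
    subst h₁
    rfl
  have := Set.ncard_le_ncard (s := Set.range g)
    (t := (blockGraph b (plantedState y S)).cliqueSet 3)
    (by
      rintro _ ⟨⟨⟨⟨x, j⟩, h⟩, k, k'⟩, rfl⟩
      rw [SimpleGraph.mem_cliqueSet_iff, SimpleGraph.is3Clique_triple_iff]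
      exact ⟨Or.inr h, Or.inr h, rfl, Bool.false_ne_true⟩) (Set.toFinite _)
  rw [← Set.image_univ, Set.ncard_image_of_injective _ hg, Set.ncard_univ,
    Nat.card_eq_fintype_card, Fintype.card_prod, Fintype.card_prod, Fintype.card_fin,
    Fintype.card_coe] at this
  rwa [sq]

end BlockGraph

/-! ### Averaging over the random choices and the hard instances -/

open Classical in
theorem probOutput_eq_tsum {n : ℕ} {O : GraphOracle n} (A : RandomizedAlgorithm O)
    (G : SimpleGraph (Fin n)) (b : Bool) :
    A.probOutput G b = ∑' T, A T * (if T.run (O.answer G) = b then 1 else 0) := by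
  rw [RandomizedAlgorithm.probOutput, PMF.map_apply]
  refine tsum_congr fun T => ?_
  by_cases h : T.run (O.answer G) = b
  · rw [if_pos h, if_pos h.symm, mul_one]
  · rw [if_neg h, if_neg (fun h' => h h'.symm), mul_zero]

open Classical in
/-- An algorithm that tells `G` from `G'` has different outputs on them with probability at least
`1 / 3`. -/
theorem third_le_tsum_run_ne {n : ℕ} {O : GraphOracle n} (A : RandomizedAlgorithm O)
    {G G' : SimpleGraph (Fin n)} (hG : 2 / 3 ≤ A.probOutput G false)
    (hG' : 2 / 3 ≤ A.probOutput G' true) :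
    1 / 3 ≤ ∑' T, A T * (if T.run (O.answer G') ≠ T.run (O.answer G) then 1 else 0) := by
  rw [probOutput_eq_tsum] at hG hG'
  have hsum := add_le_add hG hG'
  rw [← ENNReal.tsum_add] at hsum
  have hle : (2 / 3 + 2 / 3 : ENNReal) ≤
      1 + ∑' T, A T * (if T.run (O.answer G') ≠ T.run (O.answer G) then 1 else 0) := by
    refine hsum.trans ?_
    have hone : ∑' T, A T * 1 = (1 : ENNReal) := by simp_rw [mul_one, A.tsum_coe]
    refine le_trans ?_ (congrArg (· + _) hone).le
    rw [← ENNReal.tsum_add]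
    refine ENNReal.tsum_le_tsum fun T => ?_
    rw [← mul_add, ← mul_add]
    refine mul_le_mul' le_rfl ?_
    -- If both outputs are correct, they differ.
    cases T.run (O.answer G) <;> cases T.run (O.answer G') <;> simp
  have h43 : (2 / 3 + 2 / 3 : ENNReal) = 1 + 1 / 3 := by
    rw [← ENNReal.toReal_eq_toReal_iff' (by finiteness) (by finiteness)]
    rw [ENNReal.toReal_add (by finiteness) (by finiteness),
      ENNReal.toReal_add (by finiteness) (by finiteness)]
    simp
    norm_num
  rw [h43] at hle
  exact (ENNReal.add_le_add_iff_left ENNReal.one_ne_top).1 hle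

/-- Averaging over pairs of graphs: if every algorithm in the support distinguishes at most `M`
of the pairs `(G p, G' p)`, a correct algorithm forces the number of pairs to be at most `3 M`. -/
theorem card_le_three_mul_of_probOutput {n : ℕ} {O : GraphOracle n} (A : RandomizedAlgorithm O)
    {π : Type} [Fintype π] (G G' : π → SimpleGraph (Fin n)) {M : ℕ}
    (hG : ∀ p, 2 / 3 ≤ A.probOutput (G p) false) (hG' : ∀ p, 2 / 3 ≤ A.probOutput (G' p) true)
    (hM : ∀ T ∈ PMF.support A, (Finset.univ.filter fun p =>
      T.run (O.answer (G' p)) ≠ T.run (O.answer (G p))).card ≤ M) :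
    Fintype.card π ≤ 3 * M := by
  classical
  have h₁ : (Fintype.card π : ENNReal) * (1 / 3) ≤ M := by
    calc (Fintype.card π : ENNReal) * (1 / 3) = ∑ _p : π, (1 / 3 : ENNReal) := by simp
      _ ≤ ∑ p, ∑' T, A T *
          (if T.run (O.answer (G' p)) ≠ T.run (O.answer (G p)) then 1 else 0) :=
        Finset.sum_le_sum fun p _ => third_le_tsum_run_ne A (hG p) (hG' p)
      _ = ∑' T, ∑ p, A T *
          (if T.run (O.answer (G' p)) ≠ T.run (O.answer (G p)) then 1 else 0) :=
        (Summable.tsum_finsetSum fun _ _ => ENNReal.summable).symm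
      _ ≤ ∑' T, A T * M := by
        refine ENNReal.tsum_le_tsum fun T => ?_
        by_cases hT : T ∈ PMF.support A
        · rw [← Finset.mul_sum, Finset.sum_boole]
          gcongr
          exact hM T hT
        · rw [PMF.mem_support_iff, not_not] at hT
          simp [hT]
      _ = M := by rw [ENNReal.tsum_mul_right, A.tsum_coe, one_mul]
  have h₂ : (Fintype.card π : ENNReal) ≤ 3 * M := by
    calc (Fintype.card π : ENNReal) = 3 * ((Fintype.card π : ENNReal) * (1 / 3)) := by
          rw [mul_comm, mul_assoc, ENNReal.div_mul_cancel (by norm_num) (by norm_num), mul_one]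
      _ ≤ _ := by gcongr
  exact_mod_cast h₂

/-- For each `w ∈ S`, exactly one translation carries `w` to `v`. -/
theorem card_filter_mem_translate {V : Type} [AddGroup V] [Fintype V] [DecidableEq V]
    (S : Finset V) (v : V) :
    (Finset.univ.filter fun g => v ∈ S.map (Equiv.addRight g).toEmbedding).card = S.card := by
  refine Finset.card_bij' (fun g _ => v - g) (fun w _ => -w + v) ?_ ?_ ?_ ?_
  · intro g hg
    simp only [Finset.mem_filter, Finset.mem_univ, true_and, Finset.mem_map_equiv] at hg
    simpa [sub_eq_add_neg] using hg
  · intro w hw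
    simpa [sub_eq_add_neg] using hw
  · intro g _
    simp [sub_eq_add_neg]
  · intro w _
    simp [sub_eq_add_neg]

/-- The number of queries of an algorithm that counts triangles, in terms of the parameters of the
block graphs. -/
theorem mul_le_queries_of_blockGraph {c₁ c₂ : ℝ} {m n t s l b r q : ℕ} [NeZero s] [NeZero l]
    {O : GraphOracle n} (P : O.Query → Set (Sym2 (Fin n)))
    (hP : ∀ G x, O.answer G x = true ↔ ∃ e ∈ P x, e ∈ G.edgeSet)
    (A : RandomizedAlgorithm O) (hA : DecidesTriangles c₁ c₂ m t A)
    (hq : MakesAtMost c₁ c₂ m t A q) (hn : s + l * (2 * b) ≤ n)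
    (hc₁ : c₁ * m ≤ (s * l * b : ℕ)) (hc₂ : ((s + l * (2 * b)) ^ 2 : ℕ) ≤ c₂ * m)
    (hr : r ≤ s * l) (ht : 2 * t ≤ r * b ^ 2) :
    s * l ≤ 6 * q * r := by
  classical
  have hcard : Fintype.card (BlockVertex s l b) = s + l * (2 * b) := by simp
  obtain ⟨f⟩ : Nonempty (BlockVertex s l b ↪ Fin n) :=
    Function.Embedding.nonempty_of_card_le (by rw [hcard, Fintype.card_fin]; exact hn)
  obtain ⟨S₀, -, hS₀⟩ := Finset.exists_subset_card_eq (s := (Finset.univ : Finset (Fin s × Fin l)))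
    (n := r) (by simpa using hr)
  let S : Fin s × Fin l → Finset (Fin s × Fin l) := fun g =>
    S₀.map (Equiv.addRight g).toEmbedding
  let fix : O.Query → Prop := fun x =>
    ∃ j k k', s(f (.inr (j, false, k)), f (.inr (j, true, k'))) ∈ P x
  let lit : O.Query → Fin s × Fin l → Bool → Prop := fun x v c =>
    ∃ k, s(f (.inl v.1), f (.inr (v.2, c, k))) ∈ P x
  have hans : ∀ σ : Fin s × Fin l → Bool → Prop,
      O.answer ((blockGraph b σ).map f) = clauseAnswer fix lit σ := fun σ => by
    funext x
    rw [Bool.eq_iff_iff, hP, exists_mem_edgeSet_map_blockGraph_iff, clauseAnswer_eq_true_iff]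
  have hedges : ∀ σ : Fin s × Fin l → Bool → Prop, (∀ v, ∃ c, σ v c) →
      EdgesBetween c₁ c₂ m ((blockGraph b σ).map f) := fun σ hσ => by
    rw [EdgesBetween, ncard_edgeSet_map_blockGraph]
    refine ⟨hc₁.trans (Nat.cast_le.2 (mul_le_ncard_edgeSet_blockGraph σ hσ)), le_trans ?_ hc₂⟩
    exact Nat.cast_le.2 ((ncard_edgeSet_le_card_sq _).trans_eq (by rw [hcard]))
  have hplain : ∀ y : Fin s × Fin l → Bool,
      EdgesBetween c₁ c₂ m ((blockGraph b (plainState y)).map f) := fun y =>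
    hedges _ fun v => ⟨y v, rfl⟩
  have hplain' : ∀ y : Fin s × Fin l → Bool,
      numTriangles ((blockGraph b (plainState y)).map f) ≤ t := fun y => by
    rw [numTriangles_map_blockGraph, cliqueSet_blockGraph_plainState, Set.ncard_empty]
    exact Nat.zero_le _
  have hplanted : ∀ (y : Fin s × Fin l → Bool) g,
      2 * t ≤ numTriangles ((blockGraph b (plantedState y (S g))).map f) := fun y g => by
    rw [numTriangles_map_blockGraph]
    refine le_trans ?_ (mul_le_ncard_cliqueSet_blockGraph_plantedState y (S g))
    rwa [Finset.card_map, hS₀]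
  have key := card_le_three_mul_of_probOutput A
    (π := (Fin s × Fin l → Bool) × (Fin s × Fin l))
    (fun p => (blockGraph b (plainState p.1)).map f)
    (fun p => (blockGraph b (plantedState p.1 (S p.2))).map f)
    (M := 2 * q * r * Fintype.card (Fin s × Fin l → Bool))
    (fun p => (hA _ (hplain p.1)).1 (hplain' p.1))
    (fun p => (hA _ (hedges _ fun v => ⟨p.1 v, Or.inl rfl⟩)).2 (hplanted p.1 p.2))
    (fun T hT => by
      simp only [hans]
      refine card_run_ne_le fix lit S (fun v => ?_) T fun y => ?_
      · rw [← hS₀]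
        exact (card_filter_mem_translate S₀ v).le
      · rw [← hans]
        exact hq _ ⟨hplain y, Or.inl (hplain' y)⟩ T hT)
  rw [Fintype.card_prod, Fintype.card_prod, Fintype.card_fin, Fintype.card_fin] at key
  refine Nat.le_of_mul_le_mul_left (key.trans_eq ?_)
    (Fintype.card_pos (α := Fin s × Fin l → Bool))
  ring

/-! ### Choice of the parameters -/

theorem two_le_of_le_rpow {m t : ℕ} (ht : 1 ≤ t) (hm : (t : ℝ) ≤ (m : ℝ) ^ (3 / 2 : ℝ) / 2) :
    2 ≤ m := by
  by_contra h
  have hm1 : (m : ℝ) ≤ 1 := by exact_mod_cast (by omega : m ≤ 1)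
  have := Real.rpow_le_one (Nat.cast_nonneg m) hm1 (by norm_num : (0 : ℝ) ≤ 3 / 2)
  have ht' : (1 : ℝ) ≤ t := by exact_mod_cast ht
  linarith

theorem three_mul_ceil_sqrt_le {m n : ℕ} (hm : 2 ≤ m) (hn : 4 * √(m : ℝ) ≤ n) :
    3 * ⌈√(m : ℝ)⌉₊ ≤ n := by
  have hm' : (2 : ℝ) ≤ m := by exact_mod_cast hm
  -- A lower bound of `1` would not do: the rounding argument fails at `n = 5`, which `4 * 1.4 > 5`
  -- excludes.
  have hsqrt : (1.4 : ℝ) ≤ √(m : ℝ) := Real.le_sqrt_of_sq_le (by norm_num; linarith)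
  have hlt := Nat.ceil_lt_add_one (Real.sqrt_nonneg (m : ℝ))
  have h₁ : 4 * ⌈√(m : ℝ)⌉₊ < n + 4 := by
    have : (4 * ⌈√(m : ℝ)⌉₊ : ℝ) < n + 4 := by linarith
    exact_mod_cast this
  have h₂ : 5 < n := by
    have : (5 : ℝ) < n := by linarith
    exact_mod_cast this
  omega

theorem rpow_three_halves_le_pow {m s : ℕ} (h : m ≤ s ^ 2) :
    (m : ℝ) ^ (3 / 2 : ℝ) ≤ (s : ℝ) ^ 3 := by
  have h' : (m : ℝ) ≤ (s : ℝ) ^ (2 : ℝ) := by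
    rw [Real.rpow_two]
    exact_mod_cast h
  refine (Real.rpow_le_rpow (Nat.cast_nonneg m) h' (by norm_num)).trans_eq ?_
  rw [← Real.rpow_mul (Nat.cast_nonneg s), ← Real.rpow_natCast]
  norm_num

/-- The lower bound for each oracle whose queries ask for an edge in a set of pairs. -/
theorem min_le_queries {m n t q : ℕ} (ht : 1 ≤ t) (hm : (t : ℝ) ≤ (m : ℝ) ^ (3 / 2 : ℝ) / 2)
    (hn : 4 * √(m : ℝ) ≤ n) {O : GraphOracle n} (P : O.Query → Set (Sym2 (Fin n)))
    (hP : ∀ G x, O.answer G x = true ↔ ∃ e ∈ P x, e ∈ G.edgeSet) (A : RandomizedAlgorithm O)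
    (hA : DecidesTriangles (1 / 2) 36 m t A) (hq : MakesAtMost (1 / 2) 36 m t A q) :
    min ((m : ℝ) / √(t : ℝ)) ((m : ℝ) ^ (3 / 2 : ℝ) / (t : ℝ)) ≤ 36 * q := by
  have hm2 := two_le_of_le_rpow ht hm
  have h3s := three_mul_ceil_sqrt_le hm2 hn
  obtain ⟨s, hs⟩ : ∃ s, s = ⌈√(m : ℝ)⌉₊ := ⟨_, rfl⟩
  rw [← hs] at h3s
  have hm2' : (2 : ℝ) ≤ m := by exact_mod_cast hm2
  have ht' : (1 : ℝ) ≤ t := by exact_mod_cast ht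
  have hroot : √(m : ℝ) ≤ s := hs ▸ Nat.le_ceil _
  have hroot1 : 1 ≤ √(m : ℝ) := Real.le_sqrt_of_sq_le (by linarith)
  have hs2 : (s : ℝ) ≤ 2 * √(m : ℝ) := by
    have := Nat.ceil_lt_add_one (Real.sqrt_nonneg (m : ℝ))
    rw [← hs] at this
    linarith
  have hsq := Real.sq_sqrt (Nat.cast_nonneg (α := ℝ) m)
  have hms' : (m : ℝ) ≤ (s : ℝ) ^ 2 := by rw [← hsq]; gcongr
  have hms : m ≤ s ^ 2 := by exact_mod_cast hms'
  have hsm : (s : ℝ) ^ 2 ≤ 4 * m := by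
    calc (s : ℝ) ^ 2 ≤ (2 * √(m : ℝ)) ^ 2 := by gcongr
      _ = 4 * (m : ℝ) := by rw [mul_pow, hsq]; norm_num
  have hspos : 0 < s := by
    have : (0 : ℝ) < s := by linarith
    exact_mod_cast this
  have hspos' : (0 : ℝ) < s := by exact_mod_cast hspos
  have : NeZero s := ⟨hspos.ne'⟩
  have hbound : ∀ l b : ℕ, l * b ≤ s → s ≤ 2 * (l * b) → s + l * (2 * b) ≤ n ∧
      (1 / 2 : ℝ) * m ≤ (s * l * b : ℕ) ∧ ((s + l * (2 * b)) ^ 2 : ℕ) ≤ 36 * (m : ℝ) := by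
    intro l b hle hge
    have h3 : s + l * (2 * b) ≤ 3 * s := by
      have : l * (2 * b) = 2 * (l * b) := by ring
      omega
    refine ⟨h3.trans h3s, ?_, ?_⟩
    · have h4 : s * s ≤ 2 * (s * l * b) := by
        calc s * s ≤ s * (2 * (l * b)) := Nat.mul_le_mul_left _ hge
          _ = _ := by ring
      have h5 : ((s * s : ℕ) : ℝ) ≤ ((2 * (s * l * b) : ℕ) : ℝ) := Nat.cast_le.2 h4
      rw [Nat.cast_mul, Nat.cast_mul 2, Nat.cast_two, ← sq] at h5
      linarith
    · have h4 : (((s + l * (2 * b)) ^ 2 : ℕ) : ℝ) ≤ (((3 * s) ^ 2 : ℕ) : ℝ) :=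
        Nat.cast_le.2 (Nat.pow_le_pow_left h3 2)
      refine h4.trans ?_
      push_cast
      rw [mul_pow]
      linarith
  -- This decides whether one planted variable, with blocks of size at most `s`, can create `2 * t`
  -- triangles.
  by_cases hts : 2 * t ≤ s ^ 2
  · refine (min_le_left _ _).trans ?_
    obtain ⟨b, hb⟩ : ∃ b, b = ⌈√(2 * t : ℝ)⌉₊ := ⟨_, rfl⟩
    have hbs : b ≤ s := by
      rw [hb, Nat.ceil_le]
      refine (Real.sqrt_le_left (Nat.cast_nonneg s)).2 ?_
      exact_mod_cast hts
    have hb2 : 2 * t ≤ b ^ 2 := by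
      have h : √(2 * t : ℝ) ≤ b := hb ▸ Nat.le_ceil _
      have h' : (2 * t : ℝ) ≤ (b : ℝ) ^ 2 := (Real.sqrt_le_left (Nat.cast_nonneg b)).1 h
      exact_mod_cast h'
    have hbt : (b : ℝ) ≤ 3 * √(t : ℝ) := by
      have h := Nat.ceil_lt_add_one (Real.sqrt_nonneg (2 * t : ℝ))
      rw [← hb] at h
      have h1 : 1 ≤ √(t : ℝ) := Real.le_sqrt_of_sq_le (by linarith)
      have h2 : √(2 * t : ℝ) ≤ 2 * √(t : ℝ) := by
        rw [Real.sqrt_le_left (by positivity), mul_pow, Real.sq_sqrt (by positivity)]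
        linarith
      linarith
    have hbpos : 0 < b := by
      rcases Nat.eq_zero_or_pos b with h | h
      · rw [h] at hb2
        omega
      · exact h
    have hl : 0 < s / b := Nat.div_pos hbs hbpos
    have : NeZero (s / b) := ⟨hl.ne'⟩
    have hlb : s / b * b ≤ s := Nat.div_mul_le_self s b
    -- As `b ≤ s`, rounding `s` down to a multiple of `b` loses at most half.
    have hlb' : s ≤ 2 * (s / b * b) := by
      have h1 := Nat.lt_div_mul_add (a := s) hbpos
      have h2 : b ≤ s / b * b := Nat.le_mul_of_pos_left b hl
      omega
    obtain ⟨h1, h2, h3⟩ := hbound _ _ hlb hlb'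
    have key := mul_le_queries_of_blockGraph P hP A hA hq h1 h2 h3 (r := 1)
      (Nat.mul_pos hspos hl) (by rwa [one_mul])
    have hsb : s ^ 2 ≤ 12 * q * b := by
      calc s ^ 2 = s * s := sq s
        _ ≤ s * (2 * (s / b * b)) := Nat.mul_le_mul_left _ hlb'
        _ = 2 * b * (s * (s / b)) := by ring
        _ ≤ 2 * b * (6 * q * 1) := Nat.mul_le_mul_left _ key
        _ = _ := by ring
    have hsb' : (s : ℝ) ^ 2 ≤ 12 * q * b := by exact_mod_cast hsb
    rw [div_le_iff₀ (by positivity)]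
    calc (m : ℝ) ≤ 12 * q * b := hms'.trans hsb'
      _ ≤ 12 * q * (3 * √(t : ℝ)) := by gcongr
      _ = _ := by ring
  · refine (min_le_right _ _).trans ?_
    push Not at hts
    have hts' : (s : ℝ) ^ 2 ≤ 2 * t := by exact_mod_cast hts.le
    have hs3 := rpow_three_halves_le_pow hms
    obtain ⟨r, hr⟩ : ∃ r, r = ⌈(2 * t : ℝ) / (s : ℝ) ^ 2⌉₊ := ⟨_, rfl⟩
    -- With `l = 1` there are only `s` variables to plant; `t ≤ m ^ (3 / 2) / 2` ensures that they
    -- suffice.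
    have hrs : r ≤ s := by
      rw [hr, Nat.ceil_le, div_le_iff₀ (by positivity)]
      calc (2 * t : ℝ) ≤ (s : ℝ) ^ 3 := by linarith
        _ = _ := by ring
    have hrt : 2 * t ≤ r * s ^ 2 := by
      have h : (2 * t : ℝ) / (s : ℝ) ^ 2 ≤ r := hr ▸ Nat.le_ceil _
      rw [div_le_iff₀ (by positivity)] at h
      exact_mod_cast h
    have hrt' : (r : ℝ) * (s : ℝ) ^ 2 ≤ 4 * t := by
      have h := Nat.ceil_lt_add_one (by positivity : 0 ≤ (2 * t : ℝ) / (s : ℝ) ^ 2)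
      rw [← hr] at h
      calc (r : ℝ) * (s : ℝ) ^ 2 ≤ ((2 * t : ℝ) / (s : ℝ) ^ 2 + 1) * (s : ℝ) ^ 2 := by gcongr
        _ = 2 * t + (s : ℝ) ^ 2 := by field_simp
        _ ≤ 4 * t := by linarith
    obtain ⟨h1, h2, h3⟩ := hbound 1 s (by omega) (by omega)
    have key := mul_le_queries_of_blockGraph P hP A hA hq h1 h2 h3 (by omega) hrt
    rw [mul_one] at key
    have key' : (s : ℝ) ≤ 6 * q * r := by exact_mod_cast key
    rw [div_le_iff₀ (by positivity)]
    calc (m : ℝ) ^ (3 / 2 : ℝ) ≤ (s : ℝ) ^ 3 := hs3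
      _ = s * (s : ℝ) ^ 2 := by ring
      _ ≤ 6 * q * r * (s : ℝ) ^ 2 := by gcongr
      _ = 6 * q * (r * (s : ℝ) ^ 2) := by ring
      _ ≤ 6 * q * (4 * t) := by gcongr
      _ = 24 * (q * t) := by ring
      _ ≤ 36 * (q * t) := by gcongr; norm_num
      _ = 36 * q * t := by ring

/-! ### The three oracles -/

theorem eeOracle_answer_iff {n : ℕ} (G : SimpleGraph (Fin n)) (x : (eeOracle n).Query) :
    (eeOracle n).answer G x = true ↔
      ∃ e ∈ (x.1 : Set (Sym2 (Fin n))), e ∈ G.edgeSet := by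
  simp only [eeOracle, decide_eq_true_eq, SetLike.mem_coe]

theorem bisOracle_answer_iff {n : ℕ} (G : SimpleGraph (Fin n)) (x : (bisOracle n).Query) :
    (bisOracle n).answer G x = true ↔
      ∃ e ∈ {e : Sym2 (Fin n) | ∃ u ∈ x.1.1, ∃ v ∈ x.1.2, s(u, v) = e}, e ∈ G.edgeSet := by
  simp only [bisOracle, decide_eq_true_eq]
  constructor
  · rintro ⟨u, hu, v, hv, h⟩
    exact ⟨_, ⟨u, hu, v, hv, rfl⟩, h⟩
  · rintro ⟨_, ⟨u, hu, v, hv, rfl⟩, h⟩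
    exact ⟨u, hu, v, hv, h⟩

theorem isOracle_answer_iff {n : ℕ} (G : SimpleGraph (Fin n)) (x : Finset (Fin n)) :
    (isOracle n).answer G x = true ↔
      ∃ e ∈ {e : Sym2 (Fin n) | ∃ u ∈ x, ∃ v ∈ x, s(u, v) = e}, e ∈ G.edgeSet := by
  simp only [isOracle, decide_eq_true_eq]
  constructor
  · rintro ⟨u, hu, v, hv, h⟩
    exact ⟨_, ⟨u, hu, v, hv, rfl⟩, h⟩
  · rintro ⟨_, ⟨u, hu, v, hv, rfl⟩, h⟩
    exact ⟨u, hu, v, hv, h⟩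

theorem mainTheorem1 :
    ∃ (c₁ c₂ c : ℝ) (k : ℕ), 0 < c₁ ∧ c₁ ≤ c₂ ∧ 0 < c ∧
      ∀ m n t : ℕ, 1 ≤ t → (t : ℝ) ≤ (m : ℝ) ^ (3 / 2 : ℝ) / 2 → 4 * √(m : ℝ) ≤ (n : ℝ) →
        ∀ O ∈ ({eeOracle n, bisOracle n, isOracle n} : Set (GraphOracle n)),
          ∀ (A : RandomizedAlgorithm O) (q : ℕ),
            DecidesTriangles c₁ c₂ m t A → MakesAtMost c₁ c₂ m t A q →
              c * min ((m : ℝ) / √(t : ℝ)) ((m : ℝ) ^ (3 / 2 : ℝ) / (t : ℝ)) / Real.log n ^ k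
                ≤ (q : ℝ) := by
  -- `1 / 2` comes from `s ≤ 2 * (l * b)`, and `c₂ = 36` from at most `3 * s` vertices with `s ^ 2 ≤
  -- 4 * m`. The argument loses no logarithm, so `k = 0`.
  refine ⟨1 / 2, 36, 1 / 36, 0, by norm_num, by norm_num, by norm_num, ?_⟩
  intro m n t ht hm hn O hO A q hA hq
  obtain ⟨P, hP⟩ : ∃ P : O.Query → Set (Sym2 (Fin n)),
      ∀ G x, O.answer G x = true ↔ ∃ e ∈ P x, e ∈ G.edgeSet := by
    rcases hO with rfl | rfl | rfl
    · exact ⟨_, eeOracle_answer_iff⟩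
    · exact ⟨_, bisOracle_answer_iff⟩
    · exact ⟨_, isOracle_answer_iff⟩
  have := min_le_queries ht hm hn P hP A hA hq
  rw [pow_zero, div_one]
  linarith
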